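/- Let $\mathbb N_\infty=\mathbb N\cup\{\infty\}$, order $\mathbb N_\infty^n$ componentwise, and for $a\in\mathbb N_\infty^n$ put $\operatorname{ip} a=\{i: a(i)=\infty\}$. For $a_1,\dots,a_r\in\mathbb N_\infty^n$ let $\Gamma(a_1,\dots,a_r)=\{b\in\mathbb N_\infty^n: b\le a_i\text{ for some }i\}$. A multicomplex is a subset $\Gamma\subset\mathbb N_\infty^n$ which contains with $a$ every $b\le a$, and in which every element lies below a maximal element of $\Gamma$. The maximal elements of $\Gamma$ are its maximal facets; an element $a\in\Gamma$ is a facet if $\operatorname{ip}a=\operatorname{ip}m$ for every maximal facet $m\ge a$. A Stanley set is a set $S=p+S^*$ with $p\in\mathbb N^n$ and $S^*=\Gamma(m)$, $m\in\{0,\infty\}^n$. $\Gamma$ is shellable if its facets can be ordered $a_1,\dots,a_r$ such that (1) $S_i=\Gamma(a_i)\setminus\Gamma(a_1,\dots,a_{i-1})$ is a Stanley set for $i=1,\dots,r$, and (2) whenever $S_i^*\subseteq S_j^*$, then $S_i^*=S_j^*$ or $i>j$. $\Gamma$ is maximal shellable if its maximal facets can be ordered $u_1,\dots,u_r$ such that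 for some $s$ with $1\le s\le r$: (1) $\operatorname{ip}u_1=\operatorname{ip}u_j$ for all $1\le j\le s$; (2) for $i=s+1,\dots,r$ every maximal element of $\Gamma(u_1,\dots,u_{i-1})\cap\Gamma(u_i)$ differs from $u_i$ in exactly one component; (3) for all $s\le j<i\le r$, $\operatorname{ip}u_j\subseteq\operatorname{ip}u_i$ implies $\operatorname{ip}u_j=\operatorname{ip}u_i$. Let $K$ be a field, $S=K[x_1,\dots,x_n]$, and let $I(\Gamma)\subset S$ be the monomial ideal spanned over $K$ by the monomials $x^a$, $a\in\mathbb N^n\setminus\Gamma$. A ring $R$ is pretty clean if it has a chain of ideals $0=M_0\subset M_1\subset\dots\subset M_r=R$ and prime ideals $P_1,\dots,P_r$ with $M_i/M_{i-1}\cong R/P_i$ as $R$-modules for all $i$, such that $i<j$ and $P_i\subseteq P_j$ imply $P_i=P_j$. The ring $R=S/I$, with $I$ a monomial ideal and $R$ carrying its standard $\mathbb N^n$-grading, is multigraded pretty clean if the $M_i$ and $P_i$ can moreover be chosen multigraded, with isomorphisms $M_i/M_{i-1}\cong (R/P_i)(-d_i)$ of multigraded modules for suitable $d_i\in\mathbb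 N^n$. **Theorem.** If a multicomplex $\Gamma\subset\mathbb N_\infty^n$ is maximal shellable, then $\Gamma$ is shellable. In particular, for every field $K$, the ring $S/I(\Gamma)$ is pretty clean, and indeed multigraded pretty clean. -/

import Mathlib

/-! ### Multicomplexes in `ℕ_∞^n`

`ℕ_∞^n` is `Fin n → ℕ∞` with its componentwise order and addition. -/

/-- The infinite part `ip a = {i : a(i) = ∞}`. -/
def infinitePart {n : ℕ} (a : Fin n → ℕ∞) : Set (Fin n) := {i | a i = ⊤}

/-- `ℳ(Γ)`: the maximal elements of `Γ` (the maximal facets, when `Γ` is a multicomplex). -/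
def maximalFacets {n : ℕ} (Γ : Set (Fin n → ℕ∞)) : Set (Fin n → ℕ∞) :=
  {m | Maximal (fun a => a ∈ Γ) m}

/-- `Γ` is a multicomplex. -/
structure IsMulticomplex {n : ℕ} (Γ : Set (Fin n → ℕ∞)) : Prop where
  mem_of_le : ∀ a ∈ Γ, ∀ b : Fin n → ℕ∞, b ≤ a → b ∈ Γ
  exists_maximal : ∀ a ∈ Γ, ∃ m ∈ maximalFacets Γ, a ≤ m

/-- `ℱ(Γ)`: the facets of `Γ`, i.e. the faces `a` such that `ip a = ip m` for every maximal
facet `m` with `a ≤ m`. -/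
def facets {n : ℕ} (Γ : Set (Fin n → ℕ∞)) : Set (Fin n → ℕ∞) :=
  {a | a ∈ Γ ∧ ∀ m ∈ maximalFacets Γ, a ≤ m → infinitePart a = infinitePart m}

/-- `Γ(A)`: all `b` with `b ≤ a` for some `a ∈ A`. -/
def generatedBy {n : ℕ} (A : Set (Fin n → ℕ∞)) : Set (Fin n → ℕ∞) :=
  {b | ∃ a ∈ A, b ≤ a}

/-- `T` is the Stanley set `p + Γ(m)`, where `p ∈ ℕ^n` and `m ∈ {0, ∞}^n`.
(`p` and `m` are determined by `T`: they come from its least and its greatest element.) -/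
def IsStanleySetWith {n : ℕ} (T : Set (Fin n → ℕ∞)) (p : Fin n → ℕ) (m : Fin n → ℕ∞) : Prop :=
  (∀ k, m k = 0 ∨ m k = ⊤) ∧
    T = (fun c : Fin n → ℕ∞ => (fun k => (p k : ℕ∞)) + c) '' generatedBy {m}

/-- `Γ` is shellable: its facets can be ordered `a_1, …, a_r` (without repetition) such that
the sets `S_i = Γ(a_i) \ Γ(a_1, …, a_{i-1})` are Stanley sets `p_i + S_i^*`, `S_i^* = Γ(m_i)`, and
`S_i^* ⊆ S_j^*` only if `S_i^* = S_j^*` or `i > j`. -/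
def IsShellable {n : ℕ} (Γ : Set (Fin n → ℕ∞)) : Prop :=
  ∃ (r : ℕ) (a : ℕ → Fin n → ℕ∞) (p : ℕ → Fin n → ℕ) (m : ℕ → Fin n → ℕ∞),
    Set.BijOn a (Set.Icc 1 r) (facets Γ) ∧
    (∀ i ∈ Set.Icc 1 r,
      IsStanleySetWith (generatedBy {a i} \ generatedBy (a '' Set.Ico 1 i)) (p i) (m i)) ∧
    (∀ i ∈ Set.Icc 1 r, ∀ j ∈ Set.Icc 1 r,
      generatedBy {m i} ⊆ generatedBy {m j} →
        generatedBy {m i} = generatedBy {m j} ∨ j < i)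

/-- `Γ` is maximal shellable: its maximal facets can be ordered `u_1, …, u_r` (without repetition)
such that, for some `1 ≤ s ≤ r`, the three conditions below hold. -/
def IsMaximalShellable {n : ℕ} (Γ : Set (Fin n → ℕ∞)) : Prop :=
  ∃ (r s : ℕ) (u : ℕ → Fin n → ℕ∞),
    1 ≤ s ∧ s ≤ r ∧
    Set.BijOn u (Set.Icc 1 r) (maximalFacets Γ) ∧
    (∀ j, 1 ≤ j → j ≤ s → infinitePart (u 1) = infinitePart (u j)) ∧
    (∀ i, s + 1 ≤ i → i ≤ r →
      ∀ w ∈ maximalFacets (generatedBy (u '' Set.Ico 1 i) ∩ generatedBy {u i}),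
        ∃! k, w k ≠ u i k) ∧
    (∀ i j, s ≤ j → j < i → i ≤ r → infinitePart (u j) ⊆ infinitePart (u i) →
      infinitePart (u j) = infinitePart (u i))

/-! ### The monomial ideal of a multicomplex -/

/-- The monomials `x^a`, `a ∈ ℕ^n`, with `a ∉ Γ`. -/
def nonfaceMonomials (K : Type*) [Field K] {n : ℕ} (Γ : Set (Fin n → ℕ∞)) :
    Set (MvPolynomial (Fin n) K) :=
  {f | ∃ a : Fin n →₀ ℕ, (fun k => (a k : ℕ∞)) ∉ Γ ∧ f = MvPolynomial.monomial a 1}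

/-- `I(Γ) ⊆ S = K[x_1, …, x_n]`, as the ideal generated by the monomials `x^a` with `a ∉ Γ`.
For a multicomplex it is the `K`-span of these monomials (`multicomplexIdeal_eq_span`). -/
noncomputable def multicomplexIdeal (K : Type*) [Field K] {n : ℕ} (Γ : Set (Fin n → ℕ∞)) :
    Ideal (MvPolynomial (Fin n) K) :=
  Ideal.span (nonfaceMonomials K Γ)

theorem multicomplexIdeal_eq_span (K : Type*) [Field K] {n : ℕ} {Γ : Set (Fin n → ℕ∞)}
    (hΓ : IsMulticomplex Γ) :
    (multicomplexIdeal K Γ).restrictScalars K = Submodule.span K (nonfaceMonomials K Γ) := by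
  apply le_antisymm
  · intro f hf
    have hf' : f ∈ Ideal.span (nonfaceMonomials K Γ) := hf
    refine Submodule.span_induction (p := fun f _ => f ∈ Submodule.span K (nonfaceMonomials K Γ))
      (fun x hx => Submodule.subset_span hx) (Submodule.zero_mem _)
      (fun x y _ _ hx hy => Submodule.add_mem _ hx hy) ?_ hf'
    intro g x _ hx
    refine Submodule.span_induction
      (p := fun x _ => g • x ∈ Submodule.span K (nonfaceMonomials K Γ)) ?_ ?_ ?_ ?_ hx
    · rintro _ ⟨a, ha, rfl⟩
      induction g using MvPolynomial.induction_on' with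
      | monomial b c =>
        have h : (MvPolynomial.monomial b c) • (MvPolynomial.monomial a (1 : K))
            = c • MvPolynomial.monomial (b + a) (1 : K) := by
          rw [smul_eq_mul, MvPolynomial.monomial_mul, MvPolynomial.smul_monomial, smul_eq_mul]
        rw [h]
        refine Submodule.smul_mem _ _ (Submodule.subset_span ⟨b + a, fun hb => ha ?_, rfl⟩)
        refine hΓ.mem_of_le _ hb _ fun k => ?_
        simp
      | add p q hp hq =>
        rw [add_smul]
        exact Submodule.add_mem _ hp hq
    · simp
    · intro x y _ _ hx hy
      rw [smul_add]
      exact Submodule.add_mem _ hx hy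
    · intro c x _ hx
      rw [smul_comm]
      exact Submodule.smul_mem _ _ hx
  · rw [Submodule.span_le]
    intro f hf
    exact Ideal.subset_span hf

/-! ### Pretty clean modules and rings -/

/-- A prime filtration `0 = M_0 ⊆ M_1 ⊆ ⋯ ⊆ M_r = M` with isomorphisms
`M_{i+1} / M_i ≅ R / P_i` for `0 ≤ i < r`, the `P_i` being prime ideals. (The inclusions are
strict because `R / P_i ≠ 0`.) -/
structure PrimeFiltration (R M : Type*) [CommRing R] [AddCommGroup M] [Module R M] where
  /-- the length `r` -/
  length : ℕ
  /-- the submodules `M_0, …, M_r` -/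
  sub : Fin (length + 1) → Submodule R M
  sub_zero : sub 0 = ⊥
  sub_last : sub (Fin.last length) = ⊤
  sub_le : ∀ i : Fin length, sub i.castSucc ≤ sub i.succ
  /-- the prime ideals -/
  prime : Fin length → Ideal R
  isPrime : ∀ i, (prime i).IsPrime
  /-- the isomorphisms of the factors -/
  iso : ∀ i : Fin length,
    (R ⧸ prime i) ≃ₗ[R] (↥(sub i.succ) ⧸ (sub i.castSucc).submoduleOf (sub i.succ))

/-- For `i < j`, the inclusion `P_i ⊆ P_j` implies `P_i = P_j`. -/
def PrimeFiltration.IsPrettyClean {R M : Type*} [CommRing R] [AddCommGroup M] [Module R M]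
    (F : PrimeFiltration R M) : Prop :=
  ∀ i j, i < j → F.prime i ≤ F.prime j → F.prime i = F.prime j

/-- A module is pretty clean if it has a pretty clean filtration. -/
def IsPrettyCleanModule (R M : Type*) [CommRing R] [AddCommGroup M] [Module R M] : Prop :=
  ∃ F : PrimeFiltration R M, F.IsPrettyClean

/-- A ring is pretty clean if it is a pretty clean module over itself. -/
def IsPrettyCleanRing (R : Type*) [CommRing R] : Prop := IsPrettyCleanModule R R

/-- The multigraded component of degree `a` of `S / I`: the `K`-span of the class of `x^a`.
(For a monomial ideal `I` these make up the standard multigrading of `S / I`.) -/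
noncomputable def multidegreePart {K : Type*} [Field K] {n : ℕ}
    (I : Ideal (MvPolynomial (Fin n) K)) (a : Fin n →₀ ℕ) :
    Submodule K (MvPolynomial (Fin n) K ⧸ I) :=
  Submodule.span K {Ideal.Quotient.mk I (MvPolynomial.monomial a 1)}

/-- An ideal of `S / I` is multigraded if it is generated by its homogeneous elements. -/
def IsMultigradedIdeal {K : Type*} [Field K] {n : ℕ} {I : Ideal (MvPolynomial (Fin n) K)}
    (J : Ideal (MvPolynomial (Fin n) K ⧸ I)) : Prop :=
  J = Ideal.span {y | y ∈ J ∧ ∃ a, y ∈ multidegreePart I a}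

/-- A prime filtration of `R = S / I` is multigraded if the `M_i` and the `P_i` are multigraded and
each isomorphism `R / P_i → M_{i+1} / M_i` is homogeneous of some degree `d ∈ ℕ^n`, i.e. it is an
isomorphism `(R / P_i)(-d) ≅ M_{i+1} / M_i` of multigraded modules. -/
def PrimeFiltration.IsMultigraded {K : Type*} [Field K] {n : ℕ}
    {I : Ideal (MvPolynomial (Fin n) K)}
    (F : PrimeFiltration (MvPolynomial (Fin n) K ⧸ I) (MvPolynomial (Fin n) K ⧸ I)) : Prop :=
  (∀ i, IsMultigradedIdeal (F.sub i)) ∧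
  (∀ i, IsMultigradedIdeal (F.prime i)) ∧
  (∀ i, ∃ d : Fin n →₀ ℕ, ∀ b : Fin n →₀ ℕ, ∀ y ∈ multidegreePart I b,
    ∃ z : ↥(F.sub i.succ), (z : MvPolynomial (Fin n) K ⧸ I) ∈ multidegreePart I (d + b) ∧
      F.iso i (Ideal.Quotient.mk (F.prime i) y) = Submodule.Quotient.mk z)

/-- `S / I` is a multigraded pretty clean ring: it has a prime filtration, as a module over itself,
that is both multigraded and pretty clean. -/
def IsMultigradedPrettyCleanRing {K : Type*} [Field K] {n : ℕ}
    (I : Ideal (MvPolynomial (Fin n) K)) : Prop :=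
  ∃ F : PrimeFiltration (MvPolynomial (Fin n) K ⧸ I) (MvPolynomial (Fin n) K ⧸ I),
    F.IsPrettyClean ∧ F.IsMultigraded

/-! Every maximal element of `Γ(u_1, …, u_{i-1}) ∩ Γ(u_i)` differs from `u_i` in one coordinate, so
an element below `u_i` was covered earlier exactly when one of finitely many bounds on a single
coordinate holds. The bounds in the infinite directions of `u_i` thus decouple from those in the
finite ones (`exists_hasStanleyBound`); for `i ≤ s`, equality of the infinite parts already suffices
(`hasStanleyBound_zero`).

By the conditions on infinite parts, a face is a facet iff its infinite part is that of the first
`u_i` above it. Order the facets by this index, then by a linear extension of the componentwise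
order. The elements newly covered by a facet `a` are those agreeing with `a` in the finite
coordinates and meeting the lower bounds in the infinite ones: a Stanley set
(`isShellable_of_hasStanleyBound`).

On the algebraic side, if `H \ G = p + Γ(m)`, then `I(G)/I(H)` is cyclic, generated by `x^p`, with
annihilator generated by the `x_k` with `m k = 0` (`exists_quotient_equiv_of_isStanleySetWith`).
Removing facets from last to first filters `S/I(Γ)`. Inclusion of these primes reverses inclusion of
the sets `Γ(m)`, so the second shelling condition becomes pretty cleanness. -/

/-- A finite set can be enumerated increasingly with respect to an injective key. -/
theorem Set.Finite.exists_bijOn_Icc_strictMono {α L : Type*} [LinearOrder L] {F : Set α}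
    (hF : F.Finite) (key : α → L) (hkey : Function.Injective key) (hne : F.Nonempty) :
    ∃ (r : ℕ) (a : ℕ → α), Set.BijOn a (Set.Icc 1 r) F ∧
      ∀ i ∈ Set.Icc 1 r, ∀ j ∈ Set.Icc 1 r, i < j → key (a i) < key (a j) := by
  classical
  let s : Finset L := hF.toFinset.image key
  have hs : ∀ x : Fin s.card, ∃ b ∈ F, key b = s.orderEmbOfFin rfl x := by
    intro x
    obtain ⟨b, hb, h⟩ := Finset.mem_image.1 (s.orderEmbOfFin_mem rfl x)
    exact ⟨b, hF.mem_toFinset.1 hb, h⟩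
  choose b hbF hb using hs
  -- Indices start at 1, hence the shift; the value outside `1, …, s.card` is irrelevant.
  refine ⟨s.card, fun i => if h : i - 1 < s.card then b ⟨i - 1, h⟩ else hne.some, ?_⟩
  have hlt : ∀ i ∈ Set.Icc 1 s.card, i - 1 < s.card := fun i hi => by
    have := hi.1; have := hi.2; omega
  have hmono : ∀ i ∈ Set.Icc 1 s.card, ∀ j ∈ Set.Icc 1 s.card, i < j →
      key (if h : i - 1 < s.card then b ⟨i - 1, h⟩ else hne.some) <
      key (if h : j - 1 < s.card then b ⟨j - 1, h⟩ else hne.some) := by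
    intro i hi j hj hij
    rw [dif_pos (hlt i hi), dif_pos (hlt j hj), hb, hb]
    apply (s.orderEmbOfFin rfl).strictMono
    have := hi.1
    simp only [Fin.mk_lt_mk]
    omega
  refine ⟨⟨?_, ?_, ?_⟩, hmono⟩
  · intro i hi
    simp only [dif_pos (hlt i hi)]
    exact hbF _
  · intro i hi j hj hij
    rcases lt_trichotomy i j with h | h | h
    · exact absurd (congrArg key hij) (hmono i hi j hj h).ne
    · exact h
    · exact absurd (congrArg key hij) (hmono j hj i hi h).ne'
  · intro c hc
    have : key c ∈ Set.range (s.orderEmbOfFin rfl) := by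
      rw [Finset.range_orderEmbOfFin]
      simp only [s, Finset.coe_image, Set.Finite.coe_toFinset]
      exact ⟨c, hc, rfl⟩
    obtain ⟨x, hx⟩ := this
    refine ⟨x + 1, ⟨by omega, x.2⟩, ?_⟩
    have hx' : (x : ℕ) + 1 - 1 < s.card := by simp
    simp only [dif_pos hx']
    apply hkey
    rw [hb, ← hx]
    congr 1

/-! ### Lower sets in `ℕ_∞^n` -/

section Multicomplex

variable {n : ℕ}

theorem mem_generatedBy_singleton {a b : Fin n → ℕ∞} : b ∈ generatedBy {a} ↔ b ≤ a := by
  simp [generatedBy]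

theorem generatedBy_singleton_subset {a b : Fin n → ℕ∞} :
    generatedBy {a} ⊆ generatedBy {b} ↔ a ≤ b := by
  refine ⟨fun h => mem_generatedBy_singleton.1 (h (mem_generatedBy_singleton.2 le_rfl)),
    fun h c hc => mem_generatedBy_singleton.2 ((mem_generatedBy_singleton.1 hc).trans h)⟩

theorem infinitePart_mono {a b : Fin n → ℕ∞} (h : a ≤ b) : infinitePart a ⊆ infinitePart b :=
  fun k hk => top_le_iff.1 (le_of_eq_of_le (show a k = ⊤ from hk).symm (h k))

theorem mem_generatedBy_of_le {A : Set (Fin n → ℕ∞)} {a b : Fin n → ℕ∞}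
    (ha : a ∈ generatedBy A) (h : b ≤ a) : b ∈ generatedBy A :=
  let ⟨c, hc, hac⟩ := ha
  ⟨c, hc, h.trans hac⟩

/-- The intersection is generated by the finitely many meets `a ⊓ u` with `a ∈ A`, so maximal
elements exist above each of its members. -/
theorem exists_maximalFacets_generatedBy_inter {A : Set (Fin n → ℕ∞)} (hA : A.Finite)
    {u c : Fin n → ℕ∞} (hc : c ∈ generatedBy A) (hcu : c ≤ u) :
    ∃ w ∈ maximalFacets (generatedBy A ∩ generatedBy {u}), c ≤ w := by
  obtain ⟨a, haA, hca⟩ := hc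
  obtain ⟨w, hw, hmax⟩ := (hA.image (· ⊓ u)).exists_le_maximal (Set.mem_image_of_mem _ haA)
  obtain ⟨a', ha'A, rfl⟩ := hmax.prop
  refine ⟨a' ⊓ u, ⟨⟨⟨a', ha'A, inf_le_left⟩, mem_generatedBy_singleton.2 inf_le_right⟩, ?_⟩,
    (le_inf hca hcu).trans hw⟩
  rintro b ⟨⟨a'', ha'', hb⟩, hbu⟩ hle
  have hb' := le_inf hb (mem_generatedBy_singleton.1 hbu)
  exact hb'.trans (hmax.2 (Set.mem_image_of_mem _ ha'') (hle.trans hb'))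

/-! ### Decoupling finite and infinite coordinates -/

open Classical in
/-- Replace the entries of `c` with index in `U` by `∞`. -/
noncomputable def completeOn (U : Set (Fin n)) (c : Fin n → ℕ∞) : Fin n → ℕ∞ :=
  fun k => if k ∈ U then ⊤ else c k

theorem le_completeOn (U : Set (Fin n)) (c : Fin n → ℕ∞) : c ≤ completeOn U c := by
  intro k
  by_cases hk : k ∈ U <;> simp [completeOn, hk]

theorem completeOn_le {U : Set (Fin n)} {c a : Fin n → ℕ∞} (hca : c ≤ a)
    (hU : U ⊆ infinitePart a) : completeOn U c ≤ a := by
  intro k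
  by_cases hk : k ∈ U
  · rw [show a k = ⊤ from hU hk]; exact le_top
  · simpa [completeOn, hk] using hca k

/-- Membership of `c ≤ u` in the lower set `Γ(A)` is governed by lower bounds on the infinite
directions of `u` and by the finite coordinates of `c`. -/
def HasStanleyBound (A : Set (Fin n → ℕ∞)) (u : Fin n → ℕ∞) (q : Fin n → ℕ) : Prop :=
  ∀ c ≤ u, c ∉ generatedBy A ↔
    (∀ k, u k = ⊤ → (q k : ℕ∞) ≤ c k) ∧ completeOn (infinitePart u) c ∉ generatedBy A

theorem hasStanleyBound_zero {A : Set (Fin n → ℕ∞)} {u : Fin n → ℕ∞}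
    (h : ∀ a ∈ A, infinitePart a = infinitePart u) : HasStanleyBound A u 0 := by
  intro c _
  have : c ∈ generatedBy A ↔ completeOn (infinitePart u) c ∈ generatedBy A := by
    refine ⟨?_, fun hc => mem_generatedBy_of_le hc (le_completeOn _ _)⟩
    rintro ⟨a, ha, hca⟩
    exact ⟨a, ha, completeOn_le hca (h a ha).ge⟩
  simp [this]

/-- A maximal `w` of the intersection leaves `u` in one direction `k`, and `c ≤ u` lies below `w`
iff `c k ≤ w k`. If `u k = ∞`, avoiding `w` means `c k ≥ w k + 1`; if `u k` is finite, the condition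
is unaffected by completing `c`. -/
theorem exists_hasStanleyBound {A : Set (Fin n → ℕ∞)} (hA : A.Finite) {u : Fin n → ℕ∞}
    (h : ∀ w ∈ maximalFacets (generatedBy A ∩ generatedBy {u}), ∃! k, w k ≠ u k) :
    ∃ q, HasStanleyBound A u q := by
  classical
  have heq : ∀ w ∈ maximalFacets (generatedBy A ∩ generatedBy {u}), ∀ k, w k ≠ u k →
      ∀ j, j ≠ k → w j = u j := by
    intro w hw k hk j hjk
    by_contra hj
    exact hjk ((h w hw).unique hj hk)
  have hq : ∀ k, ∃ q : ℕ, ∀ w ∈ maximalFacets (generatedBy A ∩ generatedBy {u}),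
      w k ≠ u k → u k = ⊤ → (q : ℕ∞) = w k + 1 := by
    intro k
    by_cases hk : ∃ w ∈ maximalFacets (generatedBy A ∩ generatedBy {u}), w k ≠ u k ∧ u k = ⊤
    · obtain ⟨w, hw, hwk, huk⟩ := hk
      lift w k to ℕ using (by rwa [huk] at hwk) with x hx
      refine ⟨x + 1, fun w' hw' hwk' _ => ?_⟩
      -- Two maximal elements leaving `u` in the same direction agree elsewhere, so they are
      -- comparable and hence equal. The bound therefore depends on `k` alone.
      have hww : w' = w := by
        have hwk2 : w k ≠ u k := by rwa [← hx]
        have hoff : ∀ j, j ≠ k → w' j = w j := fun j hj => by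
          rw [heq w hw k hwk2 j hj, heq w' hw' k hwk' j hj]
        rcases le_total (w' k) (w k) with hl | hl
        · have : w' ≤ w := fun j => by
            by_cases hj : j = k
            · exact hj ▸ hl
            · exact (hoff j hj).le
          exact hw'.eq_of_le hw.prop this
        · have : w ≤ w' := fun j => by
            by_cases hj : j = k
            · exact hj ▸ hl
            · exact (hoff j hj).ge
          exact (hw.eq_of_le hw'.prop this).symm
      rw [hww, ← hx]
      simp
    · exact ⟨0, fun w hw h1 h2 => absurd ⟨w, hw, h1, h2⟩ hk⟩
  choose q hq using hq
  refine ⟨fun k => if ∃ w ∈ maximalFacets (generatedBy A ∩ generatedBy {u}), w k ≠ u k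
    then q k else 0, fun c hcu => ⟨fun hc => ⟨fun k huk => ?_, fun hc' =>
      hc (mem_generatedBy_of_le hc' (le_completeOn _ _))⟩, ?_⟩⟩
  · by_cases hk : ∃ w ∈ maximalFacets (generatedBy A ∩ generatedBy {u}), w k ≠ u k
    · simp only [if_pos hk]
      obtain ⟨w, hw, hwk⟩ := hk
      rw [hq k w hw hwk huk]
      by_contra hlt
      have hck : c k ≤ w k := Order.lt_add_one_iff_of_not_isMax (by
        rw [isMax_iff_eq_top]; rwa [huk] at hwk) |>.1 (not_le.1 hlt)
      refine hc (mem_generatedBy_of_le hw.prop.1 fun j => ?_)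
      by_cases hj : j = k
      · exact hj ▸ hck
      · rw [heq w hw k hwk j hj]
        exact hcu j
    · simp [if_neg hk]
  · rintro ⟨hqc, hcomp⟩ hc
    obtain ⟨w, hw, hcw⟩ := exists_maximalFacets_generatedBy_inter hA hc hcu
    obtain ⟨k, hwk, -⟩ := h w hw
    by_cases huk : u k = ⊤
    · have h1 := hqc k huk
      have hex : ∃ w ∈ maximalFacets (generatedBy A ∩ generatedBy {u}), w k ≠ u k := ⟨w, hw, hwk⟩
      simp only [if_pos hex] at h1
      rw [hq k w hw hwk huk] at h1
      have h2 := h1.trans (hcw k)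
      rw [huk] at hwk
      exact absurd h2 (not_le.2 (ENat.lt_add_one_iff hwk |>.2 le_rfl))
    -- Here `w` departs from `u` in a finite direction, so it keeps all infinite entries of `u` and
    -- lies above the completion of `c`.
    · refine hcomp (mem_generatedBy_of_le hw.prop.1
        (completeOn_le hcw fun j hj => ?_))
      have hjk : j ≠ k := by rintro rfl; exact huk hj
      exact (heq w hw k hwk j hjk).trans hj

/-! ### The ordering of the facets -/

theorem finite_setOf_le_infinitePart_eq (u : Fin n → ℕ∞) :
    {a : Fin n → ℕ∞ | a ≤ u ∧ infinitePart a = infinitePart u}.Finite := by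
  classical
  refine (Set.Finite.pi' (t := fun k => if u k = ⊤ then {⊤} else Set.Iic (u k)) ?_).subset ?_
  · intro k
    split_ifs with hk
    · exact Set.finite_singleton _
    · lift u k to ℕ using hk with x
      refine ((Set.finite_Iic x).image (fun y : ℕ => (y : ℕ∞))).subset fun y hy => ?_
      lift y to ℕ using ne_top_of_le_ne_top (ENat.natCast_ne_top x) hy
      exact ⟨y, by simpa using hy, rfl⟩
  · rintro a ⟨hau, hip⟩ k
    split_ifs with hk
    · exact hip.ge hk
    · exact hau k

/-- The least index `i ∈ {1, …, r}` with `a ≤ u i`. -/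
noncomputable def firstIndex (r : ℕ) (u : ℕ → Fin n → ℕ∞) (a : Fin n → ℕ∞) : ℕ :=
  sInf {i | i ∈ Set.Icc 1 r ∧ a ≤ u i}

theorem firstIndex_spec {r : ℕ} {u : ℕ → Fin n → ℕ∞} {a : Fin n → ℕ∞}
    (h : ∃ i ∈ Set.Icc 1 r, a ≤ u i) :
    firstIndex r u a ∈ Set.Icc 1 r ∧ a ≤ u (firstIndex r u a) :=
  Nat.sInf_mem (s := {i | i ∈ Set.Icc 1 r ∧ a ≤ u i}) h

theorem firstIndex_le {r : ℕ} {u : ℕ → Fin n → ℕ∞} {a : Fin n → ℕ∞} {i : ℕ}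
    (hi : i ∈ Set.Icc 1 r) (h : a ≤ u i) : firstIndex r u a ≤ i :=
  Nat.sInf_le ⟨hi, h⟩

theorem mem_image_add_generatedBy {p : Fin n → ℕ} {m c : Fin n → ℕ∞}
    (hm : ∀ k, m k = 0 ∨ m k = ⊤) :
    c ∈ (fun c : Fin n → ℕ∞ => (fun k => (p k : ℕ∞)) + c) '' generatedBy {m} ↔
      ∀ k, (p k : ℕ∞) ≤ c k ∧ (m k = 0 → c k = p k) := by
  constructor
  · rintro ⟨b, hb, rfl⟩ k
    refine ⟨by simp, fun hk => ?_⟩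
    have := mem_generatedBy_singleton.1 hb k
    simp only [hk, nonpos_iff_eq_zero] at this
    simp [this]
  · intro h
    refine ⟨fun k => c k - p k, mem_generatedBy_singleton.2 fun k => ?_, ?_⟩
    · rcases hm k with hk | hk
      · simp [(h k).2 hk]
      · simp [hk]
    · ext1 k
      exact add_tsub_cancel_of_le (h k).1

theorem maximalFacets_subset_facets {Γ : Set (Fin n → ℕ∞)} : maximalFacets Γ ⊆ facets Γ :=
  fun _ hm => ⟨hm.prop, fun _ hm' hle => by rw [hm.eq_of_le hm'.prop hle]⟩

/-- A multicomplex whose maximal facets are ordered with compatible infinite parts and Stanley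
bounds is shellable. -/
theorem isShellable_of_hasStanleyBound {Γ : Set (Fin n → ℕ∞)} (hΓ : IsMulticomplex Γ) {r : ℕ}
    {u : ℕ → Fin n → ℕ∞} (hr : 1 ≤ r) (hu : Set.BijOn u (Set.Icc 1 r) (maximalFacets Γ))
    (hip : ∀ i ∈ Set.Icc 1 r, ∀ j ∈ Set.Icc 1 r, i < j →
      infinitePart (u i) ⊆ infinitePart (u j) → infinitePart (u i) = infinitePart (u j))
    (hq : ∀ i ∈ Set.Icc 1 r, ∃ q, HasStanleyBound (u '' Set.Ico 1 i) (u i) q) :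
    IsShellable Γ := by
  classical
  have hex : ∀ a ∈ Γ, ∃ i ∈ Set.Icc 1 r, a ≤ u i := by
    intro a ha
    obtain ⟨m, hm, ham⟩ := hΓ.exists_maximal a ha
    obtain ⟨i, hi, rfl⟩ := hu.surjOn hm
    exact ⟨i, hi, ham⟩
  -- Any other maximal facet above `a` has a later index and a larger infinite part, so `hip` forces
  -- equality: testing the first one is enough.
  have hfacet : ∀ a, a ∈ facets Γ ↔
      a ∈ Γ ∧ infinitePart a = infinitePart (u (firstIndex r u a)) := by
    refine fun a => ⟨fun ha => ⟨ha.1, ?_⟩, fun ha => ⟨ha.1, fun m hm ham => ?_⟩⟩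
    · have := firstIndex_spec (hex a ha.1)
      exact ha.2 _ (hu.mapsTo this.1) this.2
    · obtain ⟨j, hj, rfl⟩ := hu.surjOn hm
      rcases (firstIndex_le hj ham).lt_or_eq with hlt | heq
      · rw [ha.2]
        exact hip _ (firstIndex_spec (hex a ha.1)).1 j hj hlt (ha.2 ▸ infinitePart_mono ham)
      · rw [ha.2, heq]
  have hfin : (facets Γ).Finite := by
    refine ((Set.finite_Icc 1 r).biUnion fun i _ =>
      finite_setOf_le_infinitePart_eq (u i)).subset fun a ha => ?_
    have := firstIndex_spec (hex a ha.1)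
    exact Set.mem_biUnion this.1 ⟨this.2, ((hfacet a).1 ha).2⟩
  -- The lexicographic order serves only as a linear extension of the componentwise order.
  let key : (Fin n → ℕ∞) → ℕ ×ₗ Lex (Fin n → ℕ∞) := fun a => toLex (firstIndex r u a, toLex a)
  have hkeyinj : Function.Injective key := fun a b hab => by
    have := congrArg (fun x => ofLex (ofLex x).2) hab
    simpa [key] using this
  have hkey_lt : ∀ a b, key a < key b ↔ firstIndex r u a < firstIndex r u b ∨
      firstIndex r u a = firstIndex r u b ∧ toLex a < toLex b := fun a b => by
    simp [key, Prod.Lex.toLex_lt_toLex]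
  obtain ⟨N, a, ha, hmono⟩ := hfin.exists_bijOn_Icc_strictMono key hkeyinj
    ⟨u 1, maximalFacets_subset_facets (hu.mapsTo ⟨le_rfl, hr⟩)⟩
  have hprev : ∀ i ∈ Set.Icc 1 N, ∀ b, b ∈ a '' Set.Ico 1 i ↔ b ∈ facets Γ ∧ key b < key (a i) := by
    intro i hi b
    constructor
    · rintro ⟨j, hj, rfl⟩
      have hj' : j ∈ Set.Icc 1 N := ⟨hj.1, (hj.2.trans_le hi.2).le⟩
      exact ⟨ha.mapsTo hj', hmono j hj' i hi hj.2⟩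
    · rintro ⟨hb, hlt⟩
      obtain ⟨j, hj, rfl⟩ := ha.surjOn hb
      refine ⟨j, ⟨hj.1, ?_⟩, rfl⟩
      by_contra hji
      rcases (not_lt.1 hji).lt_or_eq with h | h
      · exact lt_asymm hlt (hmono i hi j hj h)
      · rw [h] at hlt; exact lt_irrefl _ hlt
  choose! q hq using hq
  let U : ℕ → Fin n → ℕ∞ := fun i => u (firstIndex r u (a i))
  -- The base point takes the Stanley bounds in infinite directions and the entries of `a i` in
  -- finite ones; `toNat` loses nothing, since `a i` and `U i` have the same infinite part.
  refine ⟨N, a, fun i k => if U i k = ⊤ then q (firstIndex r u (a i)) k else (a i k).toNat,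
    fun i k => if U i k = ⊤ then ⊤ else 0, ha, fun i hi => ?_, fun i hi j hj hij => ?_⟩
  · have hm : ∀ k, (if U i k = ⊤ then ⊤ else 0 : ℕ∞) = 0 ∨
        (if U i k = ⊤ then ⊤ else 0 : ℕ∞) = ⊤ := fun k => by split_ifs <;> simp
    refine ⟨hm, ?_⟩
    ext c
    rw [mem_image_add_generatedBy hm]
    have haF := ha.mapsTo hi
    have hai := (hfacet _).1 haF
    obtain ⟨hI, haU⟩ := firstIndex_spec (hex _ hai.1)
    have hQ := hq _ hI
    have hconv : ∀ b ∈ Γ, b ∈ generatedBy (u '' Set.Ico 1 (firstIndex r u (a i))) ↔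
        firstIndex r u b < firstIndex r u (a i) := by
      intro b hb
      constructor
      · rintro ⟨_, ⟨j, hj, rfl⟩, hbj⟩
        exact (firstIndex_le ⟨hj.1, (hj.2.trans_le hI.2).le⟩ hbj).trans_lt hj.2
      · intro hlt
        have := firstIndex_spec (hex b hb)
        exact ⟨_, ⟨_, ⟨this.1.1, hlt⟩, rfl⟩, this.2⟩
    have hipk : ∀ k, a i k = ⊤ ↔ U i k = ⊤ := fun k => by
      have := Set.ext_iff.1 hai.2 k
      exact this
    constructor
    · rintro ⟨hca, hcprev⟩
      rw [mem_generatedBy_singleton] at hca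
      have hcΓ := hΓ.mem_of_le _ hai.1 _ hca
      have hc : c ∉ generatedBy (u '' Set.Ico 1 (firstIndex r u (a i))) := by
        intro hc
        rw [hconv c hcΓ] at hc
        have hs := firstIndex_spec (hex c hcΓ)
        refine hcprev ⟨_, (hprev i hi _).2
          ⟨maximalFacets_subset_facets (hu.mapsTo hs.1), ?_⟩, hs.2⟩
        rw [hkey_lt]
        exact Or.inl ((firstIndex_le hs.1 le_rfl).trans_lt hc)
      obtain ⟨hqc, hcomp⟩ := (hQ c (hca.trans haU)).1 hc
      set c' := completeOn (infinitePart (u (firstIndex r u (a i)))) c with hc'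
      have hc'a : c' ≤ a i := completeOn_le hca hai.2.ge
      have hc'Γ := hΓ.mem_of_le _ hai.1 _ hc'a
      have hidx : firstIndex r u c' = firstIndex r u (a i) := by
        rw [hconv _ hc'Γ] at hcomp
        exact le_antisymm (firstIndex_le hI (hc'a.trans haU)) (not_lt.1 hcomp)
      have hc'ip : infinitePart c' = infinitePart (u (firstIndex r u (a i))) := by
        refine (hai.2 ▸ infinitePart_mono hc'a).antisymm fun k hk => ?_
        simp [infinitePart, hc', completeOn] at hk ⊢
        tauto
      -- The completion `c'` is a facet with the same first index; were it strictly below `a i`, it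
      -- would come earlier and already cover `c`.
      have hc'eq : c' = a i := by
        by_contra hne
        refine hcprev ⟨c', (hprev i hi _).2 ⟨(hfacet _).2 ⟨hc'Γ, by rw [hidx, hc'ip]⟩, ?_⟩,
          le_completeOn _ _⟩
        rw [hkey_lt]
        exact Or.inr ⟨hidx, Pi.toLex_strictMono (lt_of_le_of_ne hc'a hne)⟩
      have hck : ∀ k, U i k ≠ ⊤ → c k = a i k := by
        intro k hk
        rw [← hc'eq, hc', completeOn, if_neg (by exact hk)]
      intro k
      by_cases hk : U i k = ⊤
      · simp only [hk, if_true]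
        exact ⟨hqc k hk, fun h => by simp at h⟩
      · simp only [hk, if_false]
        rw [hck k hk, ENat.natCast_toNat (fun h => hk ((hipk k).1 h))]
        simp
    · intro h
      have hqc : ∀ k, U i k = ⊤ → (q (firstIndex r u (a i)) k : ℕ∞) ≤ c k := fun k hk => by
        simpa [hk] using (h k).1
      have hck : ∀ k, U i k ≠ ⊤ → c k = a i k := fun k hk => by
        have := (h k).2 (by simp [hk])
        simp only [if_neg hk] at this
        rwa [ENat.natCast_toNat (fun h => hk ((hipk k).1 h))] at this
      have hcomp : completeOn (infinitePart (u (firstIndex r u (a i)))) c = a i := by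
        ext1 k
        by_cases hk : U i k = ⊤
        · rw [completeOn, if_pos (by exact hk), (hipk k).2 hk]
        · rw [completeOn, if_neg (by exact hk), hck k hk]
      have hca : c ≤ a i := hcomp ▸ le_completeOn _ _
      have hcΓ := hΓ.mem_of_le _ hai.1 _ hca
      refine ⟨mem_generatedBy_singleton.2 hca, ?_⟩
      rintro ⟨b, hb, hcb⟩
      obtain ⟨hbF, hblt⟩ := (hprev i hi b).1 hb
      have hc : c ∉ generatedBy (u '' Set.Ico 1 (firstIndex r u (a i))) := by
        refine (hQ c (hca.trans haU)).2 ⟨hqc, ?_⟩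
        rw [hcomp, hconv _ hai.1]
        exact lt_irrefl _
      have hbi := firstIndex_spec (hex b hbF.1)
      rcases (hkey_lt _ _).1 hblt with hlt | ⟨heq, hlt⟩
      · exact hc ⟨_, ⟨_, ⟨hbi.1.1, hlt⟩, rfl⟩, hcb.trans hbi.2⟩
      -- An earlier facet with the same first index has the same infinite part, so above `c` it is
      -- also above the completion `a i`, against the order.
      · have hle : a i ≤ b := by
          rw [← hcomp]
          refine completeOn_le hcb ?_
          rw [((hfacet b).1 hbF).2, heq]
        exact absurd hlt (not_lt.2 (Pi.toLex_monotone hle))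
  · rcases lt_or_ge j i with hlt | hle
    · exact Or.inr hlt
    left
    rw [generatedBy_singleton_subset] at hij
    have hsub : infinitePart (U i) ⊆ infinitePart (U j) := fun k hk => by
      have := hij k
      by_contra hk'
      simp [show U i k = ⊤ from hk, show ¬ U j k = ⊤ from hk'] at this
    have heq : infinitePart (U i) = infinitePart (U j) := by
      have hI := (firstIndex_spec (hex _ (ha.mapsTo hi).1)).1
      have hJ := (firstIndex_spec (hex _ (ha.mapsTo hj).1)).1
      rcases hle.lt_or_eq with hlt | rfl
      · rcases (hkey_lt _ _).1 (hmono i hi j hj hlt) with h | h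
        · exact hip _ hI _ hJ h hsub
        · simp only [U, h.1]
      · rfl
    congr 2
    ext1 k
    have : U i k = ⊤ ↔ U j k = ⊤ := Set.ext_iff.1 heq k
    simp only [this]

theorem IsMaximalShellable.isShellable {Γ : Set (Fin n → ℕ∞)} (hΓ : IsMulticomplex Γ)
    (h : IsMaximalShellable Γ) : IsShellable Γ := by
  obtain ⟨r, s, u, hs, hsr, hu, h1, h2, h3⟩ := h
  refine isShellable_of_hasStanleyBound hΓ (hs.trans hsr) hu ?_ ?_
  · intro i hi j hj hij hsub
    rcases le_or_gt s i with hsi | his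
    · exact h3 j i hsi hij hj.2 hsub
    -- All of `u 1, …, u s` share one infinite part, so `u s` can stand in for `u i` in the third
    -- condition.
    · have his' : infinitePart (u i) = infinitePart (u s) := by
        rw [← h1 i hi.1 his.le, h1 s hs le_rfl]
      rcases le_or_gt j s with hjs | hsj
      · rw [← h1 i hi.1 his.le, h1 j hj.1 hjs]
      · rw [his'] at hsub ⊢
        exact h3 j s le_rfl hsj hj.2 hsub
  · intro i hi
    rcases le_or_gt i s with his | hsi
    · refine ⟨0, hasStanleyBound_zero ?_⟩
      rintro _ ⟨j, hj, rfl⟩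
      rw [← h1 i hi.1 his, h1 j hj.1 (hj.2.le.trans his)]
    · exact exists_hasStanleyBound ((Set.finite_Ico 1 i).image u) (h2 i hsi hi.2)

end Multicomplex

/-! ### Monomial ideals and the prime filtration -/

section MonomialIdeals

open MvPolynomial

variable {n : ℕ} {K : Type*} [Field K]

theorem isLowerSet_generatedBy (A : Set (Fin n → ℕ∞)) : IsLowerSet (generatedBy A) :=
  fun _ _ h ha => mem_generatedBy_of_le ha h

/-- The exponent vector `b` as an element of `ℕ_∞^n`. -/
def exponentFace (b : Fin n →₀ ℕ) : Fin n → ℕ∞ := fun k => (b k : ℕ∞)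

theorem exponentFace_add (b c : Fin n →₀ ℕ) :
    exponentFace (b + c) = exponentFace b + exponentFace c := by
  ext1 k
  simp [exponentFace]

theorem nonfaceMonomials_eq_image (G : Set (Fin n → ℕ∞)) :
    nonfaceMonomials K G = (fun b => monomial b (1 : K)) '' {b | exponentFace b ∉ G} := by
  ext f
  constructor
  · rintro ⟨b, hb, rfl⟩
    exact ⟨b, hb, rfl⟩
  · rintro ⟨b, hb, rfl⟩
    exact ⟨b, hb, rfl⟩

theorem mem_multicomplexIdeal {G : Set (Fin n → ℕ∞)} (hG : IsLowerSet G)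
    {f : MvPolynomial (Fin n) K} :
    f ∈ multicomplexIdeal K G ↔ ∀ b ∈ f.support, exponentFace b ∉ G := by
  rw [multicomplexIdeal, nonfaceMonomials_eq_image, mem_ideal_span_monomial_image]
  refine forall₂_congr fun b _ => ⟨?_, fun h => ⟨b, h, le_rfl⟩⟩
  rintro ⟨c, hc, hcb⟩ hb
  exact hc (hG (fun k => by simpa [exponentFace] using hcb k) hb)

theorem multicomplexIdeal_anti {G H : Set (Fin n → ℕ∞)} (h : G ⊆ H) :
    multicomplexIdeal K H ≤ multicomplexIdeal K G :=
  Ideal.span_mono fun _ ⟨b, hb, hf⟩ => ⟨b, fun hb' => hb (h hb'), hf⟩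

theorem multicomplexIdeal_empty : multicomplexIdeal K (∅ : Set (Fin n → ℕ∞)) = ⊤ := by
  rw [Ideal.eq_top_iff_one, mem_multicomplexIdeal (fun _ _ _ h => h)]
  simp

/-- The ideal is the kernel of the substitution killing the variables in `s`, an endomorphism of a
domain that is the identity modulo the ideal. -/
theorem isPrime_span_X_image (s : Set (Fin n)) :
    (Ideal.span (X '' s : Set (MvPolynomial (Fin n) K))).IsPrime := by
  classical
  let φ : MvPolynomial (Fin n) K →ₐ[K] MvPolynomial (Fin n) K :=
    aeval fun k => if k ∈ s then 0 else X k
  have hker : Ideal.span (X '' s) = RingHom.ker φ := by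
    apply le_antisymm
    · rw [Ideal.span_le]
      rintro _ ⟨k, hk, rfl⟩
      simp [φ, RingHom.mem_ker, hk]
    · intro f hf
      have hcomp : (Ideal.Quotient.mkₐ K (Ideal.span (X '' s : Set (MvPolynomial (Fin n) K)))).comp φ
          = Ideal.Quotient.mkₐ K _ := by
        ext k
        by_cases hk : k ∈ s
        · simp only [φ, AlgHom.comp_apply, aeval_X, hk, if_true, map_zero]
          exact (Ideal.Quotient.eq_zero_iff_mem.2 (Ideal.subset_span (Set.mem_image_of_mem X hk))).symm
        · simp [φ, hk]
      have := DFunLike.congr_fun hcomp f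
      rw [AlgHom.comp_apply, show φ f = 0 from hf, map_zero] at this
      exact Ideal.Quotient.eq_zero_iff_mem.1 this.symm
  rw [hker]
  exact RingHom.ker_isPrime φ

theorem span_X_image_le_iff {s t : Set (Fin n)} :
    Ideal.span (X '' s : Set (MvPolynomial (Fin n) K)) ≤ Ideal.span (X '' t) ↔ s ⊆ t := by
  refine ⟨fun h k hk => ?_, fun h => Ideal.span_mono (Set.image_mono h)⟩
  have := h (Ideal.subset_span ⟨k, hk, rfl⟩)
  rw [mem_ideal_span_X_image] at this
  obtain ⟨i, hi, hne⟩ := this (Finsupp.single k 1) (by simp [support_X])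
  rw [Finsupp.single_apply_ne_zero] at hne
  exact hne.1 ▸ hi

theorem mul_monomial_mem_multicomplexIdeal {G : Set (Fin n → ℕ∞)} (hG : IsLowerSet G)
    {f : MvPolynomial (Fin n) K} {p : Fin n →₀ ℕ} :
    f * monomial p 1 ∈ multicomplexIdeal K G ↔
      ∀ b ∈ f.support, exponentFace (p + b) ∉ G := by
  rw [mem_multicomplexIdeal hG]
  constructor
  · intro h b hb
    refine h (p + b) ?_
    rw [mem_support_iff, add_comm, coeff_mul_monomial, mul_one]
    exact mem_support_iff.1 hb
  · intro h c hc
    rw [mem_support_iff, coeff_mul_monomial'] at hc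
    split_ifs at hc with hpc
    · rw [← add_tsub_cancel_of_le hpc]
      exact h _ (mem_support_iff.2 (by simpa using hc))
    · exact absurd rfl hc

theorem isMultigradedIdeal_map_span {I : Ideal (MvPolynomial (Fin n) K)}
    {T : Set (MvPolynomial (Fin n) K)} (hT : ∀ f ∈ T, ∃ b, f = monomial b 1) :
    IsMultigradedIdeal ((Ideal.span T).map (Ideal.Quotient.mk I)) := by
  apply le_antisymm
  · rw [Ideal.map_span, Ideal.span_le]
    rintro _ ⟨f, hf, rfl⟩
    refine Ideal.subset_span ⟨Ideal.subset_span ⟨f, hf, rfl⟩, ?_⟩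
    obtain ⟨b, rfl⟩ := hT f hf
    exact ⟨b, Submodule.subset_span rfl⟩
  · rw [Ideal.span_le]
    exact fun y hy => hy.1

/-- If `M = N + (x)` and `P = (N : x)`, then multiplication by `x` identifies `R / P` with
`M / N`. -/
theorem exists_quotient_equiv_of_colon {R : Type*} [CommRing R] {M N P : Ideal R} {x : R}
    (hx : x ∈ M) (hM : M ≤ N ⊔ Ideal.span {x}) (hP : ∀ y, y ∈ P ↔ y * x ∈ N) :
    ∃ e : (R ⧸ P) ≃ₗ[R] (↥M ⧸ N.submoduleOf M), ∀ y,
      e (Ideal.Quotient.mk P y) = Submodule.Quotient.mk ⟨y * x, M.mul_mem_left y hx⟩ := by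
  let φ : R →ₗ[R] (↥M ⧸ N.submoduleOf M) :=
    (N.submoduleOf M).mkQ ∘ₗ LinearMap.toSpanSingleton R M ⟨x, hx⟩
  have hker : P = LinearMap.ker φ := by
    ext y
    rw [hP, LinearMap.mem_ker]
    simp only [φ, LinearMap.comp_apply, Submodule.mkQ_apply, Submodule.Quotient.mk_eq_zero]
    rfl
  have hsurj : Function.Surjective φ := by
    intro z
    obtain ⟨⟨w, hw⟩, rfl⟩ := Submodule.Quotient.mk_surjective _ z
    obtain ⟨v, hv, t, ht, hvt⟩ := Submodule.mem_sup.1 (hM hw)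
    obtain ⟨y, rfl⟩ := Ideal.mem_span_singleton'.1 ht
    refine ⟨y, ?_⟩
    simp only [φ, LinearMap.comp_apply, Submodule.mkQ_apply]
    rw [Submodule.Quotient.eq]
    change y * x - w ∈ N
    rw [← hvt]
    simpa using hv
  subst hker
  exact ⟨φ.quotKerEquivOfSurjective hsurj, fun y => rfl⟩

/-- Removing a Stanley set from a lower set yields a factor of the form `R / P`, where `P` is
generated by variables. -/
theorem exists_quotient_equiv_of_isStanleySetWith {Γ G H : Set (Fin n → ℕ∞)}
    (hG : IsLowerSet G) (hH : IsLowerSet H) (hHΓ : H ⊆ Γ)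
    {p : Fin n → ℕ} {m : Fin n → ℕ∞} (hS : IsStanleySetWith (H \ G) p m) :
    ((Ideal.span (X '' {k | m k = 0})).map
        (Ideal.Quotient.mk (multicomplexIdeal K Γ))).IsPrime ∧
      Ideal.span (X '' {k | m k = 0}) =
        ((Ideal.span (X '' {k | m k = 0})).map
          (Ideal.Quotient.mk (multicomplexIdeal K Γ))).comap
            (Ideal.Quotient.mk (multicomplexIdeal K Γ)) ∧
      ∃ (d : Fin n →₀ ℕ) (hd : Ideal.Quotient.mk _ (monomial d 1) ∈
          (multicomplexIdeal K G).map (Ideal.Quotient.mk (multicomplexIdeal K Γ)))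
        (e : ((MvPolynomial (Fin n) K ⧸ multicomplexIdeal K Γ) ⧸
            (Ideal.span (X '' {k | m k = 0})).map (Ideal.Quotient.mk (multicomplexIdeal K Γ)))
          ≃ₗ[MvPolynomial (Fin n) K ⧸ multicomplexIdeal K Γ]
          (↥((multicomplexIdeal K G).map (Ideal.Quotient.mk (multicomplexIdeal K Γ))) ⧸
            ((multicomplexIdeal K H).map (Ideal.Quotient.mk (multicomplexIdeal K Γ))).submoduleOf
              ((multicomplexIdeal K G).map (Ideal.Quotient.mk (multicomplexIdeal K Γ))))),
        ∀ y, e (Ideal.Quotient.mk _ y) =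
          Submodule.Quotient.mk ⟨y * Ideal.Quotient.mk _ (monomial d 1),
            Ideal.mul_mem_left _ y hd⟩ := by
  set I := multicomplexIdeal K Γ
  set P : Ideal (MvPolynomial (Fin n) K) := Ideal.span (X '' {k | m k = 0}) with hPdef
  have hmk : Function.Surjective (Ideal.Quotient.mk I) := Ideal.Quotient.mk_surjective
  obtain ⟨hm, hS⟩ := hS
  let d : Fin n →₀ ℕ := Finsupp.equivFunOnFinite.symm p
  have hd : exponentFace d = fun k => (p k : ℕ∞) := rfl
  have hmemS : ∀ b : Fin n →₀ ℕ, exponentFace b ∈ H \ G ↔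
      ∀ k, p k ≤ b k ∧ (m k = 0 → b k = p k) := by
    intro b
    rw [hS, mem_image_add_generatedBy hm]
    simp [exponentFace]
  have hdS : exponentFace d ∈ H \ G := (hmemS d).2 fun k => ⟨le_rfl, fun _ => rfl⟩
  have hdle : ∀ b : Fin n →₀ ℕ, exponentFace d ≤ exponentFace (d + b) := fun b => by
    rw [exponentFace_add]
    exact le_self_add
  have hdadd : ∀ b : Fin n →₀ ℕ, exponentFace (d + b) ∉ H ↔ ∃ k ∈ {k | m k = 0}, b k ≠ 0 := by
    intro b
    have h1 : exponentFace (d + b) ∈ H ↔ exponentFace (d + b) ∈ H \ G :=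
      ⟨fun h => ⟨h, fun h' => hdS.2 (hG (hdle b) h')⟩, fun h => h.1⟩
    rw [h1, hmemS]
    simp [d]
  -- Since `x^(d+b)` never returns to `G`, it leaves `H` exactly when `b` involves a direction in
  -- which the Stanley set is bounded.
  have hcolon : ∀ f, f ∈ P ↔ f * monomial d 1 ∈ multicomplexIdeal K H := fun f => by
    rw [mul_monomial_mem_multicomplexIdeal hH, hPdef, mem_ideal_span_X_image]
    simp_rw [hdadd]
  have hIH : I ≤ multicomplexIdeal K H := multicomplexIdeal_anti hHΓ
  have hcomapMap : ∀ J : Ideal (MvPolynomial (Fin n) K), I ≤ J →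
      (J.map (Ideal.Quotient.mk I)).comap (Ideal.Quotient.mk I) = J := fun J hJ => by
    rw [Ideal.comap_map_of_surjective _ hmk, ← RingHom.ker_eq_comap_bot, Ideal.mk_ker,
      sup_eq_left.2 hJ]
  have hIP : I ≤ P := fun f hf => (hcolon f).2 (Ideal.mul_mem_right _ _ (hIH hf))
  have hPprime : P.IsPrime := isPrime_span_X_image _
  have hdG : monomial d (1 : K) ∈ multicomplexIdeal K G := Ideal.subset_span ⟨d, hdS.2, rfl⟩
  have hdG' := Ideal.mem_map_of_mem (Ideal.Quotient.mk I) hdG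
  refine ⟨Ideal.map_isPrime_of_surjective hmk (by rwa [Ideal.mk_ker]),
    (hcomapMap P hIP).symm, d, hdG', exists_quotient_equiv_of_colon hdG' ?_ ?_⟩
  · have : multicomplexIdeal K G ≤ multicomplexIdeal K H ⊔ Ideal.span {monomial d 1} := by
      conv_lhs => rw [multicomplexIdeal]
      rw [Ideal.span_le]
      rintro _ ⟨b, hb, rfl⟩
      by_cases hbH : exponentFace b ∈ H
      · refine Ideal.mem_sup_right (Ideal.mem_span_singleton.2 ?_)
        have := (hmemS b).1 ⟨hbH, hb⟩
        exact monomial_dvd_monomial.2 ⟨Or.inr fun k => (this k).1, dvd_rfl⟩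
      · exact Ideal.mem_sup_left (Ideal.subset_span ⟨b, hbH, rfl⟩)
    refine (Ideal.map_mono this).trans ?_
    rw [Ideal.map_sup, Ideal.map_span, Set.image_singleton]
  · intro y
    obtain ⟨f, rfl⟩ := hmk y
    rw [← map_mul, ← Ideal.mem_comap, ← Ideal.mem_comap, hcomapMap P hIP,
      hcomapMap _ hIH, hcolon]

theorem generatedBy_facets {Γ : Set (Fin n → ℕ∞)} (hΓ : IsMulticomplex Γ) :
    generatedBy (facets Γ) = Γ := by
  ext b
  constructor
  · rintro ⟨a, ha, hba⟩
    exact hΓ.mem_of_le a ha.1 b hba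
  · intro hb
    obtain ⟨m, hm, hbm⟩ := hΓ.exists_maximal b hb
    exact ⟨m, maximalFacets_subset_facets hm, hbm⟩

/-- The ring of a shellable multicomplex is multigraded pretty clean. -/
theorem IsShellable.isMultigradedPrettyCleanRing {Γ : Set (Fin n → ℕ∞)} (hΓ : IsMulticomplex Γ)
    (h : IsShellable Γ) : IsMultigradedPrettyCleanRing (multicomplexIdeal K Γ) := by
  obtain ⟨r, a, p, m, ha, hS, hm⟩ := h
  let π := Ideal.Quotient.mk (multicomplexIdeal K Γ)
  have hπ : Function.Surjective π := Ideal.Quotient.mk_surjective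
  let G : ℕ → Set (Fin n → ℕ∞) := fun i => generatedBy (a '' Set.Ico 1 i)
  let V : ℕ → Ideal (MvPolynomial (Fin n) K) := fun i => Ideal.span (X '' {k | m i k = 0})
  have hGlast : G (r + 1) = Γ := by
    have : Set.Ico 1 (r + 1) = Set.Icc 1 r := by
      ext i
      simp only [Set.mem_Ico, Set.mem_Icc]
      omega
    simp only [G]
    rw [this, ha.image_eq, generatedBy_facets hΓ]
  have hGmono : ∀ i j, i ≤ j → G i ⊆ G j := fun i j hij _ ⟨x, hx, hbx⟩ =>
    ⟨x, Set.image_mono (Set.Ico_subset_Ico_right hij) hx, hbx⟩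
  have hdiff : ∀ i ∈ Set.Icc 1 r, IsStanleySetWith (G (i + 1) \ G i) (p i) (m i) := by
    intro i hi
    have hIco : Set.Ico 1 (i + 1) = insert i (Set.Ico 1 i) := by
      have := hi.1
      ext j
      simp only [Set.mem_Ico, Set.mem_insert_iff]
      omega
    have : G (i + 1) \ G i = generatedBy {a i} \ generatedBy (a '' Set.Ico 1 i) := by
      ext b
      simp only [G, hIco, Set.image_insert_eq, Set.mem_sdiff]
      refine and_congr_left fun hb => ⟨?_, ?_⟩
      · rintro ⟨x, rfl | hx, hbx⟩
        · exact ⟨_, rfl, hbx⟩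
        · exact absurd ⟨x, hx, hbx⟩ hb
      · rintro ⟨x, hx, hbx⟩
        exact ⟨x, Or.inl hx, hbx⟩
    rw [this]
    exact hS i hi
  have hstep := fun (i : ℕ) (hi : i ∈ Set.Icc 1 r) =>
    exists_quotient_equiv_of_isStanleySetWith (K := K) (isLowerSet_generatedBy _)
      (isLowerSet_generatedBy _) (hGlast ▸ hGmono (i + 1) (r + 1) (Nat.succ_le_succ hi.2)) (hdiff i hi)
  have hmem : ∀ i : Fin r, r - i ∈ Set.Icc 1 r := fun i => ⟨by omega, by omega⟩
  have hsucc : ∀ i : Fin r, r - (i.succ : ℕ) + 1 = r - i := fun i => by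
    simp only [Fin.val_succ]; omega
  choose hprime hcomap d hd e he using hstep
  have hsub : ∀ i : Fin r, (multicomplexIdeal K (G (r - (i.succ : ℕ) + 1))).map π =
      (multicomplexIdeal K (G (r - i))).map π := fun i => by rw [hsucc]
  -- The indices `r - (i+1) + 1` and `r - i` agree only propositionally. Stating the formula through
  -- an existential `z` lets the isomorphism survive the rewriting.
  have hiso : ∀ i : Fin r, ∃ f : ((MvPolynomial (Fin n) K ⧸ multicomplexIdeal K Γ) ⧸
      (V (r - i)).map π) ≃ₗ[MvPolynomial (Fin n) K ⧸ multicomplexIdeal K Γ]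
      (↥((multicomplexIdeal K (G (r - (i.succ : ℕ) + 1))).map π) ⧸
        ((multicomplexIdeal K (G (r - (i.castSucc : ℕ) + 1))).map π).submoduleOf
          ((multicomplexIdeal K (G (r - (i.succ : ℕ) + 1))).map π)),
      ∀ y, ∃ z : ↥((multicomplexIdeal K (G (r - (i.succ : ℕ) + 1))).map π),
        (z : MvPolynomial (Fin n) K ⧸ multicomplexIdeal K Γ) =
          y * π (monomial (d (r - i) (hmem i)) 1) ∧
        f (Ideal.Quotient.mk _ y) = Submodule.Quotient.mk z := by
    intro i
    rw [hsub i]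
    exact ⟨e _ (hmem i), fun y => ⟨_, rfl, he _ (hmem i) y⟩⟩
  choose f hf using hiso
  let F : PrimeFiltration (MvPolynomial (Fin n) K ⧸ multicomplexIdeal K Γ)
      (MvPolynomial (Fin n) K ⧸ multicomplexIdeal K Γ) :=
    { length := r
      -- `G j` is generated by the facets of index below `j`, so this stage keeps the first `r - i`
      -- facets, and the next step removes facet `r - i`.
      sub := fun i => (multicomplexIdeal K (G (r - i + 1))).map π
      sub_zero := by
        rw [Fin.val_zero, Nat.sub_zero, hGlast]
        exact Ideal.map_quotient_self _
      sub_last := by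
        have : G (r - (Fin.last r : ℕ) + 1) = ∅ := by
          simp [G, generatedBy]
        rw [this, multicomplexIdeal_empty, Ideal.map_top]
      sub_le := fun i => Ideal.map_mono (multicomplexIdeal_anti (hGmono _ _ (by
        simp only [Fin.val_succ, Fin.val_castSucc]; omega)))
      prime := fun i => (V (r - i)).map π
      isPrime := fun i => hprime _ (hmem i)
      iso := f }
  refine ⟨F, ?_, ?_, ?_, ?_⟩
  -- Both the indices and the inclusions are reversed, so the shelling condition is applied to the
  -- pair `r - j`, `r - i`.
  · intro (i : Fin r) (j : Fin r) hij hle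
    change (V (r - i)).map π ≤ (V (r - j)).map π at hle
    change (V (r - i)).map π = (V (r - j)).map π
    have h1 := Ideal.comap_mono (f := π) hle
    rw [← hcomap _ (hmem i), ← hcomap _ (hmem j), span_X_image_le_iff] at h1
    have h2 : generatedBy {m (r - j)} ⊆ generatedBy {m (r - i)} := by
      rw [generatedBy_singleton_subset]
      intro k
      rcases (hdiff _ (hmem i)).1 k with hk | hk
      · rw [show m (r - j) k = 0 from h1 hk]
        exact zero_le
      · rw [hk]
        exact le_top
    rcases hm _ (hmem j) _ (hmem i) h2 with h3 | h3
    · have : m (r - j) = m (r - i) :=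
        le_antisymm (generatedBy_singleton_subset.1 h3.le) (generatedBy_singleton_subset.1 h3.ge)
      simp only [V, this]
    · exact absurd h3 (not_lt.2 (Nat.sub_le_sub_left (Fin.le_def.1 hij.le) r))
  · intro i
    refine isMultigradedIdeal_map_span ?_
    rintro _ ⟨b, _, rfl⟩
    exact ⟨b, rfl⟩
  · intro i
    refine isMultigradedIdeal_map_span ?_
    rintro _ ⟨k, _, rfl⟩
    exact ⟨Finsupp.single k 1, rfl⟩
  · intro i
    refine ⟨d _ (hmem i), fun b y hy => ?_⟩
    obtain ⟨z, hz, hfz⟩ := hf i y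
    refine ⟨z, ?_, hfz⟩
    obtain ⟨c, rfl⟩ := Submodule.mem_span_singleton.1 hy
    rw [hz]
    refine Submodule.mem_span_singleton.2 ⟨c, ?_⟩
    rw [smul_mul_assoc, ← map_mul, monomial_mul, one_mul, add_comm]

theorem IsMultigradedPrettyCleanRing.isPrettyCleanRing {I : Ideal (MvPolynomial (Fin n) K)}
    (h : IsMultigradedPrettyCleanRing I) : IsPrettyCleanRing (MvPolynomial (Fin n) K ⧸ I) :=
  let ⟨F, hF, _⟩ := h
  ⟨F, hF⟩

end MonomialIdeals

theorem theorem3p6 {n : ℕ} (Γ : Set (Fin n → ℕ∞)) (hΓ : IsMulticomplex Γ)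
    (hmax : IsMaximalShellable Γ) (K : Type*) [Field K] :
    IsShellable Γ ∧
      IsPrettyCleanRing (MvPolynomial (Fin n) K ⧸ multicomplexIdeal K Γ) ∧
      IsMultigradedPrettyCleanRing (multicomplexIdeal K Γ) := by
  have hshell := hmax.isShellable hΓ
  have hclean := hshell.isMultigradedPrettyCleanRing (K := K) hΓ
  exact ⟨hshell, hclean.isPrettyCleanRing, hclean⟩
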